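/- Let $A=\{0,1\}$, let $\varphi:A^*\to A^*$ be the Thue--Morse morphism $\varphi(0)=01$, $\varphi(1)=10$, and let $\mathbf t=011010011001\cdots$ be the Thue--Morse word, i.e. the fixed point of $\varphi$ starting with $0$, with letters indexed from $0$. For a letter $a$, let $\bar a$ denote the other letter. For words $w,x$, let $\binom{w}{x}$ be the number of occurrences of $x$ as a (scattered) subsequence of $w$. Words $u,v$ are *$k$-binomially equivalent*, $u\sim_k v$, if $\binom ux=\binom vx$ for all words $x$ over $A$ with $|x|\le k$. For a factor $u$ of $\mathbf t$, a *cutting set of order $k$* of $u$ is a non-empty set of the form $C=\{j : 0\le j\le |u|,\ i+j\in 2^k\mathbb N\}$, where $i\ge 0$ is such that $u=\mathbf t_{[i,i+|u|)}$. The *factorization of order $k$ of $u$ associated with $C$* is the pair $(p,s)$ such that $|p|=\min C$, $|s|=|u|-\max C$ and $u=p\,\varphi^k(w)\,s$ for some word $w$, where $p$ is empty or a proper suffix of $\varphi^k(a)$ for a letter $a$, and $s$ is empty or a proper prefix of $\varphi^k(b)$ for a letter $b$. If $|u|\ge 2^k-1$, the word $u$ has at least one factorization of order $k$, and $(p_u,s_u)$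 denotes the unique one for which $|p_u|$ is minimal. Two pairs $(p_1,s_1)$, $(p_2,s_2)$ of words of length less than $2^k$ satisfy $(p_1,s_1)\equiv_k(p_2,s_2)$ if there is a letter $a\in A$ such that one of the following holds: 1. $|p_1|+|s_1|=|p_2|+|s_2|$ and at least one of (a) $(p_1,s_1)=(p_2,s_2)$; (b) $(p_1,\varphi^{k-1}(a)s_1)=(p_2\varphi^{k-1}(a),s_2)$; (c) $(p_2,\varphi^{k-1}(a)s_2)=(p_1\varphi^{k-1}(a),s_1)$; (d) $(p_1,s_1)=(s_2,p_2)=(\varphi^{k-1}(a),\varphi^{k-1}(\bar a))$; 2. $\bigl||p_1|+|s_1|-(|p_2|+|s_2|)\bigr|=2^k$ and at least one of (a) $(p_1,s_1)=(p_2\varphi^{k-1}(a),\varphi^{k-1}(\bar a)s_2)$; (b) $(p_2,s_2)=(p_1\varphi^{k-1}(a),\varphi^{k-1}(\bar a)s_1)$. **Theorem.** Let $k\ge 3$ and let $u,v$ be factors of $\mathbf t$ of the same length $n\ge 2^k-1$. Then $(p_u,s_u)$ and $(p_v,s_v)$ are well defined, and $$u\sim_k v \iff (p_u,s_u)\equiv_k(p_v,s_v).$$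 -/

import Mathlib

namespace ThueMorse

/-- Finite words over the alphabet `{0, 1}`; `false` is the letter `0`, `true` is the letter `1`. -/
abbrev Word := List Bool

/-- The Thue–Morse morphism `0 ↦ 01`, `1 ↦ 10`. -/
def φ (w : Word) : Word := w.flatMap fun a => [a, !a]

/-- The (0-indexed) letters of the Thue–Morse word `t`, the fixed point of `φ` starting with `0`:
the words `φ^n(0)`, of length `2^n > n`, are prefixes of one another, and `t` is their limit. -/
def t (n : ℕ) : Bool := (φ^[n] [false]).getD n false

/-- The word `t_{[i, i+n)}`. -/
def tFactor (i n : ℕ) : Word := (List.range n).map fun j => t (i + j)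

/-- The set of factors of length `n` of the Thue–Morse word. -/
def Fac (n : ℕ) : Set Word := {u | ∃ i, u = tFactor i n}

/-- The binomial coefficient of words: the number of occurrences of `x` as a subsequence of `u`
(`List.sublists` lists the subsequences of `u` with multiplicity, one for each set of positions). -/
def binom (u x : Word) : ℕ := u.sublists.count x

/-- `k`-binomial equivalence. -/
def BinomEquiv (k : ℕ) (u v : Word) : Prop :=
  ∀ x : Word, x.length ≤ k → binom u x = binom v x

/-- The position of the `n`-th cutting bar of order `k`. -/
def bar (k n : ℕ) : ℕ := (φ^[k] (tFactor 0 n)).length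

/-- The set of cutting sets of order `k` of `u`: for each occurrence `u = t_{[i, i+|u|)}`, the set
`([i, i+|u|] ∩ bar_k(ℕ)) - i`, provided that it is non-empty. -/
def Cut (k : ℕ) (u : Word) : Set (Set ℕ) :=
  {C | C.Nonempty ∧ ∃ i, u = tFactor i u.length ∧
    C = {j | j ≤ u.length ∧ i + j ∈ Set.range (bar k)}}

/-- `q = (p, s)` is the factorization of `u` associated with the cutting set `C` of order `k`:
`u = p φ^k(v) s`, where `p` ends at the first and `s` starts at the last cutting bar. -/
def IsFactorizationOf (k : ℕ) (u : Word) (C : Set ℕ) (q : Word × Word) : Prop :=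
  IsLeast C q.1.length ∧
  (∃ m, IsGreatest C m ∧ m + q.2.length = u.length) ∧
  (∃ v : Word, u = q.1 ++ φ^[k] v ++ q.2) ∧
  (q.1 = [] ∨ ∃ a : Bool, q.1 <:+ φ^[k] [a] ∧ q.1 ≠ φ^[k] [a]) ∧
  (q.2 = [] ∨ ∃ b : Bool, q.2 <+: φ^[k] [b] ∧ q.2 ≠ φ^[k] [b])

/-- `q = (p, s)` is a factorization of order `k` of `u`. -/
def IsFactorization (k : ℕ) (u : Word) (q : Word × Word) : Prop :=
  ∃ C ∈ Cut k u, IsFactorizationOf k u C q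

/-- `q = (p_u, s_u)`: the factorization of order `k` of `u` for which `|p_u|` is minimal. -/
def IsMinFactorization (k : ℕ) (u : Word) (q : Word × Word) : Prop :=
  IsFactorization k u q ∧ ∀ q', IsFactorization k u q' → q.1.length ≤ q'.1.length

/-- The relation `≡_k` on pairs of words of length less than `2^k`. -/
def TypeEquiv (k : ℕ) (q₁ q₂ : Word × Word) : Prop :=
  (q₁.1.length < 2 ^ k ∧ q₁.2.length < 2 ^ k ∧ q₂.1.length < 2 ^ k ∧ q₂.2.length < 2 ^ k) ∧
  ∃ a : Bool,
    (q₁.1.length + q₁.2.length = q₂.1.length + q₂.2.length ∧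
      (q₁ = q₂ ∨
       (q₁.1, φ^[k - 1] [a] ++ q₁.2) = (q₂.1 ++ φ^[k - 1] [a], q₂.2) ∨
       (q₂.1, φ^[k - 1] [a] ++ q₂.2) = (q₁.1 ++ φ^[k - 1] [a], q₁.2) ∨
       (q₁ = (φ^[k - 1] [a], φ^[k - 1] [!a]) ∧ (q₂.2, q₂.1) = (φ^[k - 1] [a], φ^[k - 1] [!a])))) ∨
    (|((q₁.1.length + q₁.2.length : ℕ) : ℤ) - ((q₂.1.length + q₂.2.length : ℕ) : ℤ)| = 2 ^ k ∧
      (q₁ = (q₂.1 ++ φ^[k - 1] [a], φ^[k - 1] [!a] ++ q₂.2) ∨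
       q₂ = (q₁.1 ++ φ^[k - 1] [a], φ^[k - 1] [!a] ++ q₁.2)))

end ThueMorse

/-!
Cut two factors of the same length at bars of order `k - 1`: `u = p φ^(k-1)(x) s` and
`v = p' φ^(k-1)(y) s'`.

If `p = p'`, `s = s'` and `y` is a rearrangement of `x`, then `u ∼_k v`: under the Magnus transform,
`u ∼_k v` says that the noncommutative polynomials of `u` and `v` agree up to degree `k`, and a
commutator `(U - V)(V - 1) - (V - 1)(U - V)` lies one degree deeper than `U - V`, so by induction
`φ^k(0) ∼_k φ^k(1)` and blocks `φ^(k-1)(a)` commute up to `∼_k`. The relation `≡_k` lists the ways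
in which the ends of the factors can differ by such a rearrangement.

Conversely, `u ∼_k v` makes `∑ (-1)^(u_i) z^i - ∑ (-1)^(v_i) z^i` divisible by `(z - 1)^k`. For
`φ^j(x)` this polynomial is `∏_{i<j} (1 - z^(2^i))` times the one of `x` at `z^(2^j)`, hence when
the ends `p, s` of order `j` agree, `x` and `y` have the same balance if `j < k`, and the same first
moment if `j + 1 < k`. Refining the cuts from order `j + 1` to order `j`, these two equations and
the absence of runs of three equal letters in `t` show, by induction on `j < k`, that the ends of
order `j` agree unless `u = v`; equality of the balances at order `k - 1` then is `≡_k`.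
-/

namespace ThueMorse
open Polynomial

section Morphism

@[simp] lemma φ_nil : φ [] = [] := rfl

@[simp] lemma φ_cons (a : Bool) (w : Word) : φ (a :: w) = a :: (!a) :: φ w := rfl

lemma φ_append (u v : Word) : φ (u ++ v) = φ u ++ φ v := List.flatMap_append

lemma length_φ (w : Word) : (φ w).length = 2 * w.length := by
  simp [φ, mul_comm]

@[simp] lemma φ_iterate_nil (k : ℕ) : φ^[k] [] = [] := Function.iterate_fixed φ_nil k

@[simp] lemma φ_iterate_append (k : ℕ) (u v : Word) : φ^[k] (u ++ v) = φ^[k] u ++ φ^[k] v := by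
  induction k generalizing u v with
  | zero => rfl
  | succ k ih => simp only [Function.iterate_succ_apply, φ_append, ih]

lemma φ_iterate_cons (k : ℕ) (a : Bool) (w : Word) :
    φ^[k] (a :: w) = φ^[k] [a] ++ φ^[k] w :=
  φ_iterate_append k [a] w

@[simp] lemma length_φ_iterate (k : ℕ) (w : Word) : (φ^[k] w).length = 2 ^ k * w.length := by
  induction k generalizing w with
  | zero => simp
  | succ k ih => rw [Function.iterate_succ_apply, ih, length_φ]; ring

lemma φ_iterate_succ_singleton (k : ℕ) (a : Bool) :
    φ^[k + 1] [a] = φ^[k] [a] ++ φ^[k] [!a] := by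
  rw [Function.iterate_succ_apply, ← φ_iterate_append]; rfl

lemma getD_φ_two_mul (w : Word) (n : ℕ) : (φ w).getD (2 * n) false = w.getD n false := by
  induction w generalizing n with
  | nil => simp
  | cons a w ih =>
    cases n with
    | zero => simp
    | succ n => simpa [Nat.mul_succ] using ih n

lemma getD_φ_two_mul_add_one {w : Word} {n : ℕ} (hn : n < w.length) :
    (φ w).getD (2 * n + 1) false = !w.getD n false := by
  induction w generalizing n with
  | nil => simp at hn
  | cons a w ih =>
    cases n with
    | zero => simp
    | succ n => simpa [Nat.mul_succ] using ih (Nat.lt_of_succ_lt_succ hn)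

end Morphism

section Letters

lemma getD_φ_iterate_of_le {j k n : ℕ} (hjk : j ≤ k) (hn : n < 2 ^ j) :
    (φ^[k] [false]).getD n false = (φ^[j] [false]).getD n false := by
  induction k, hjk using Nat.le_induction with
  | base => rfl
  | succ k hk ih =>
    have : n < 2 ^ k := hn.trans_le (Nat.pow_le_pow_right two_pos hk)
    rw [← ih, φ_iterate_succ_singleton, List.getD_append _ _ _ _ (by simpa using this)]

lemma t_eq_getD {k n : ℕ} (hn : n < 2 ^ k) : t n = (φ^[k] [false]).getD n false := by
  rcases le_total n k with h | h
  · exact (getD_φ_iterate_of_le h Nat.lt_two_pow_self).symm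
  · exact getD_φ_iterate_of_le h hn

lemma t_two_mul (n : ℕ) : t (2 * n) = t n := by
  have hn : n < 2 ^ n := Nat.lt_two_pow_self
  rw [t_eq_getD (k := n + 1) (by rw [pow_succ]; lia), Function.iterate_succ_apply',
    getD_φ_two_mul, t_eq_getD hn]

lemma t_two_mul_add_one (n : ℕ) : t (2 * n + 1) = !t n := by
  have hn : n < 2 ^ n := Nat.lt_two_pow_self
  rw [t_eq_getD (k := n + 1) (by rw [pow_succ]; lia), Function.iterate_succ_apply',
    getD_φ_two_mul_add_one (by simpa using hn), t_eq_getD hn]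

lemma t_two_pow_mul_add (k e : ℕ) {j : ℕ} (hj : j < 2 ^ k) :
    t (2 ^ k * e + j) = xor (t e) (t j) := by
  induction k generalizing j with
  | zero =>
    obtain rfl : j = 0 := by simpa using hj
    simp [show t 0 = false from rfl]
  | succ k ih =>
    rcases Nat.even_or_odd' j with ⟨i, rfl | rfl⟩
    · rw [show 2 ^ (k + 1) * e + 2 * i = 2 * (2 ^ k * e + i) by ring, t_two_mul, t_two_mul,
        ih (by rw [pow_succ] at hj; lia)]
    · rw [show 2 ^ (k + 1) * e + (2 * i + 1) = 2 * (2 ^ k * e + i) + 1 by ring,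
        t_two_mul_add_one, t_two_mul_add_one, ih (by rw [pow_succ] at hj; lia), Bool.xor_not]

end Letters

section Factors

@[simp] lemma length_tFactor (i n : ℕ) : (tFactor i n).length = n := by simp [tFactor]

@[simp] lemma tFactor_zero (i : ℕ) : tFactor i 0 = [] := rfl

@[simp] lemma tFactor_one (i : ℕ) : tFactor i 1 = [t i] := rfl

lemma tFactor_two (i : ℕ) : tFactor i 2 = [t i, t (i + 1)] := rfl

lemma tFactor_add (i m n : ℕ) : tFactor i (m + n) = tFactor i m ++ tFactor (i + m) n := by
  simp [tFactor, List.range_add, add_assoc]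

lemma tFactor_eq_iff {i j m : ℕ} :
    tFactor i m = tFactor j m ↔ ∀ l < m, t (i + l) = t (j + l) := by
  simp [tFactor]

lemma tFactor_eq_replicate_iff {i m : ℕ} {a : Bool} :
    tFactor i m = List.replicate m a ↔ ∀ l < m, t (i + l) = a := by
  simp [tFactor, List.eq_replicate_iff]

lemma le_two_of_tFactor_eq_replicate {i m : ℕ} {a : Bool}
    (h : tFactor i m = List.replicate m a) : m ≤ 2 := by
  by_contra! hm
  rw [tFactor_eq_replicate_iff] at h
  have h₀ := h 0 (by lia)
  have h₁ := h 1 (by lia)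
  have h₂ := h 2 (by lia)
  rcases Nat.even_or_odd' i with ⟨c, rfl | rfl⟩
  · rw [t_two_mul_add_one, ← t_two_mul, ← add_zero (2 * c), h₀] at h₁
    exact Bool.not_ne_self a h₁
  · rw [show 2 * c + 1 + 2 = 2 * (c + 1) + 1 by ring, t_two_mul_add_one, ← t_two_mul,
      show 2 * (c + 1) = 2 * c + 1 + 1 by ring, h₁] at h₂
    exact Bool.not_ne_self a h₂

lemma length_of_mem_Fac {n : ℕ} {u : Word} (hu : u ∈ Fac n) : u.length = n := by
  obtain ⟨i, rfl⟩ := hu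
  exact length_tFactor i n

lemma φ_tFactor (i m : ℕ) : φ (tFactor i m) = tFactor (2 * i) (2 * m) := by
  induction m with
  | zero => rfl
  | succ m ih =>
    rw [tFactor_add, φ_append, ih, Nat.mul_succ, tFactor_add, ← Nat.mul_add, tFactor_two,
      t_two_mul_add_one, t_two_mul]
    rfl

lemma φ_iterate_tFactor (k i m : ℕ) :
    φ^[k] (tFactor i m) = tFactor (2 ^ k * i) (2 ^ k * m) := by
  induction k generalizing i m with
  | zero => simp
  | succ k ih => rw [Function.iterate_succ_apply, φ_tFactor, ih]; ring_nf

lemma φ_iterate_letter (k i : ℕ) : φ^[k] [t i] = tFactor (2 ^ k * i) (2 ^ k) := by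
  rw [← tFactor_one, φ_iterate_tFactor, mul_one]

lemma bar_eq (k n : ℕ) : bar k n = 2 ^ k * n := by simp [bar]

end Factors

section SignPolynomial

/-- The sign `(-1)^a` of a letter `a`. -/
def ε (a : Bool) : ℤ := if a then -1 else 1

lemma ε_not (a : Bool) : ε (!a) = -ε a := by cases a <;> rfl

variable {R : Type*} [CommRing R]

/-- The polynomial `∑ ε(w_i) z^i` attached to the word `w = w_0 w_1 ⋯`, evaluated at `z`. -/
def signPoly (z : R) : Word → R
  | [] => 0
  | a :: w => ε a + z * signPoly z w

@[simp] lemma signPoly_nil (z : R) : signPoly z [] = 0 := rfl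

@[simp] lemma signPoly_cons (z : R) (a : Bool) (w : Word) :
    signPoly z (a :: w) = ε a + z * signPoly z w := rfl

lemma signPoly_append (z : R) (u v : Word) :
    signPoly z (u ++ v) = signPoly z u + z ^ u.length * signPoly z v := by
  induction u with
  | nil => simp
  | cons a u ih => simp [ih]; ring

lemma signPoly_φ (z : R) (w : Word) : signPoly z (φ w) = (1 - z) * signPoly (z ^ 2) w := by
  induction w with
  | nil => simp
  | cons a w ih => simp [ih, ε_not]; ring

lemma signPoly_φ_iterate (z : R) (k : ℕ) (w : Word) :
    signPoly z (φ^[k] w) =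
      (∏ i ∈ Finset.range k, (1 - z ^ 2 ^ i)) * signPoly (z ^ 2 ^ k) w := by
  induction k generalizing w with
  | zero => simp
  | succ k ih =>
    rw [Function.iterate_succ_apply, ih, signPoly_φ, Finset.prod_range_succ, ← pow_mul,
      ← pow_succ]
    ring

end SignPolynomial

section Balance

/-- The number of letters `0` minus the number of letters `1`. -/
def balance (w : Word) : ℤ := (w.map ε).sum

/-- The first moment `∑ i ε(w_i)` of the signs of `w`. -/
def moment : Word → ℤ
  | [] => 0
  | _ :: w => moment w + balance w

@[simp] lemma balance_nil : balance [] = 0 := rfl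

@[simp] lemma balance_cons (a : Bool) (w : Word) : balance (a :: w) = ε a + balance w := by
  simp [balance]

@[simp] lemma balance_append (u v : Word) : balance (u ++ v) = balance u + balance v := by
  simp [balance]

@[simp] lemma balance_φ (w : Word) : balance (φ w) = 0 := by
  induction w with
  | nil => rfl
  | cons a w ih => simp [ih, ε_not]

lemma abs_balance_le (w : Word) : |balance w| ≤ w.length := by
  induction w with
  | nil => simp
  | cons a w ih =>
    rw [balance_cons, List.length_cons]
    have : |ε a| = 1 := by cases a <;> rfl
    push_cast
    linarith [abs_add_le (ε a) (balance w)]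

lemma eq_replicate_of_balance_eq {w : Word} {a : Bool} (h : balance w = w.length * ε a) :
    w = List.replicate w.length a := by
  induction w with
  | nil => rfl
  | cons b w ih =>
    have hw := abs_le.1 (abs_balance_le w)
    rw [balance_cons, List.length_cons] at h
    push_cast at h
    obtain rfl : b = a := by cases a <;> cases b <;> simp [ε] at h ⊢ <;> lia
    rw [List.length_cons, List.replicate_succ, ← ih (by linarith)]

lemma balance_eq_length_sub_two_mul_count (w : Word) :
    balance w = w.length - 2 * w.count true := by
  induction w with
  | nil => rfl
  | cons a w ih => cases a <;> simp [ih, ε] <;> ring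

lemma perm_of_balance_eq {x y : Word} (hlen : x.length = y.length)
    (hbal : balance x = balance y) : x.Perm y := by
  rw [balance_eq_length_sub_two_mul_count, balance_eq_length_sub_two_mul_count, hlen] at hbal
  have htrue : x.count true = y.count true := by lia
  have hx := List.count_true_add_count_false x
  have hy := List.count_true_add_count_false y
  refine List.perm_iff_count.2 fun a => ?_
  cases a <;> lia

@[simp] lemma moment_nil : moment [] = 0 := rfl

@[simp] lemma moment_cons (a : Bool) (w : Word) : moment (a :: w) = moment w + balance w := rfl

lemma moment_eq_zero_of_length_le_one {w : Word} (h : w.length ≤ 1) : moment w = 0 := by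
  rcases w with _ | ⟨a, _ | _⟩ <;> simp_all

lemma moment_append (u v : Word) :
    moment (u ++ v) = moment u + moment v + u.length * balance v := by
  induction u with
  | nil => simp
  | cons a u ih => simp [ih]; ring

lemma moment_φ (w : Word) : moment (φ w) = -balance w := by
  induction w with
  | nil => rfl
  | cons a w ih => simp [ih, ε_not]

end Balance

section Divisibility

lemma coeff_zero_signPoly (N : ℕ) (w : Word) :
    (signPoly ((1 + X : ℤ[X]) ^ N) w).coeff 0 = balance w := by
  induction w with
  | nil => simp
  | cons a w ih => simp [mul_coeff_zero, ih, coeff_zero_eq_eval_zero (_ ^ _)]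

lemma coeff_one_signPoly (N : ℕ) (w : Word) :
    (signPoly ((1 + X : ℤ[X]) ^ N) w).coeff 1 = N * moment w := by
  induction w with
  | nil => simp
  | cons a w ih =>
    have hε : (ε a : ℤ[X]).coeff 1 = 0 := by rw [← C_eq_intCast, coeff_C_succ]
    simp [mul_coeff_one, ih, hε, coeff_zero_signPoly, coeff_one_add_X_pow]
    ring

lemma exists_one_sub_pow_eq_X_mul {N : ℕ} (hN : N ≠ 0) :
    ∃ g : ℤ[X], 1 - (1 + X) ^ N = X * g ∧ ¬X ∣ g := by
  refine ⟨-∑ j ∈ Finset.range N, (1 + X) ^ j, ?_, ?_⟩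
  · have := mul_geom_sum (1 + X : ℤ[X]) N
    rw [add_sub_cancel_left] at this
    rw [mul_neg, this, neg_sub]
  · simp [X_dvd_iff, coeff_zero_eq_eval_zero, eval_finsetSum, hN]

lemma exists_prod_one_sub_pow_eq_X_pow_mul (k : ℕ) :
    ∃ g : ℤ[X], ∏ i ∈ Finset.range k, (1 - (1 + X) ^ 2 ^ i) = X ^ k * g ∧ ¬X ∣ g := by
  induction k with
  | zero => exact ⟨1, by simp, by simp [X_dvd_iff]⟩
  | succ k ih =>
    obtain ⟨g, hg, hXg⟩ := ih
    obtain ⟨f, hf, hXf⟩ := exists_one_sub_pow_eq_X_mul (pow_ne_zero k two_ne_zero)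
    refine ⟨g * f, ?_, prime_X.not_dvd_mul hXg hXf⟩
    rw [Finset.prod_range_succ, hg, hf]
    ring

lemma X_pow_dvd_signPoly_sub {k e : ℕ} {p s x y : Word} (hlen : x.length = y.length)
    (h : X ^ (k + e) ∣ signPoly (1 + X : ℤ[X]) (p ++ φ^[k] x ++ s) -
      signPoly (1 + X : ℤ[X]) (p ++ φ^[k] y ++ s)) :
    X ^ e ∣ signPoly ((1 + X : ℤ[X]) ^ 2 ^ k) x - signPoly ((1 + X : ℤ[X]) ^ 2 ^ k) y := by
  obtain ⟨g, hg, hXg⟩ := exists_prod_one_sub_pow_eq_X_pow_mul k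
  have hX : ¬X ∣ (1 + X : ℤ[X]) ^ p.length * g :=
    prime_X.not_dvd_mul (fun hd => by simpa [X_dvd_iff] using prime_X.dvd_of_dvd_pow hd) hXg
  refine prime_X.pow_dvd_of_dvd_mul_left _ hX <|
    (mul_dvd_mul_iff_left (pow_ne_zero k X_ne_zero)).1 ?_
  rw [← pow_add]
  convert h using 1
  simp only [signPoly_append, signPoly_φ_iterate, hg, List.length_append, length_φ_iterate, hlen]
  ring

lemma balance_eq_of_X_pow_dvd {k : ℕ} {p s x y : Word} (hlen : x.length = y.length)
    (h : X ^ (k + 1) ∣ signPoly (1 + X : ℤ[X]) (p ++ φ^[k] x ++ s) -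
      signPoly (1 + X : ℤ[X]) (p ++ φ^[k] y ++ s)) :
    balance x = balance y := by
  have := X_pow_dvd_iff.1 (X_pow_dvd_signPoly_sub hlen h) 0 one_pos
  rwa [coeff_sub, coeff_zero_signPoly, coeff_zero_signPoly, sub_eq_zero] at this

lemma moment_eq_of_X_pow_dvd {k : ℕ} {p s x y : Word} (hlen : x.length = y.length)
    (h : X ^ (k + 2) ∣ signPoly (1 + X : ℤ[X]) (p ++ φ^[k] x ++ s) -
      signPoly (1 + X : ℤ[X]) (p ++ φ^[k] y ++ s)) :
    moment x = moment y := by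
  have := X_pow_dvd_iff.1 (X_pow_dvd_signPoly_sub hlen h) 1 one_lt_two
  rw [coeff_sub, coeff_one_signPoly, coeff_one_signPoly, sub_eq_zero] at this
  exact mul_left_cancel₀ (by positivity) this

end Divisibility

section Magnus

variable {R α : Type*}

/-- The noncommutative polynomials all of whose terms have degree at least `k`. -/
def orderGE (R α : Type*) [Ring R] (k : ℕ) : AddSubgroup (MonoidAlgebra R (FreeMonoid α)) where
  carrier := {f | ∀ x : FreeMonoid α, x.length < k → f.coeff x = 0}
  zero_mem' _ _ := rfl
  add_mem' hf hg x hx := by simp [hf x hx, hg x hx]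
  neg_mem' hf x hx := by simp [hf x hx]

lemma mul_mem_orderGE [Ring R] {i j : ℕ} {f g : MonoidAlgebra R (FreeMonoid α)}
    (hf : f ∈ orderGE R α i) (hg : g ∈ orderGE R α j) : f * g ∈ orderGE R α (i + j) := by
  classical
  intro x hx
  rw [MonoidAlgebra.coeff_mul]
  refine Finset.sum_eq_zero fun a _ => Finset.sum_eq_zero fun b _ => ite_eq_right_iff.2 ?_
  rintro rfl
  rw [FreeMonoid.length_mul] at hx
  rcases lt_or_ge a.length i with ha | ha
  · rw [hf a ha, zero_mul]
  · rw [hg b (by lia), mul_zero]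

lemma mem_orderGE_zero [Ring R] (f : MonoidAlgebra R (FreeMonoid α)) : f ∈ orderGE R α 0 :=
  fun _ hx => absurd hx (Nat.not_lt_zero _)

lemma single_of_mem_orderGE [Ring R] (a : α) (r : R) :
    MonoidAlgebra.single (FreeMonoid.of a) r ∈ orderGE R α 1 := by
  classical
  intro x hx
  obtain rfl := FreeMonoid.length_eq_zero.1 (Nat.lt_one_iff.1 hx)
  simp

/-- The Magnus transform `∏ (1 + w_i)` of a word in noncommuting variables. -/
noncomputable def magnus (w : List α) : MonoidAlgebra ℤ (FreeMonoid α) :=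
  (w.map fun a => 1 + MonoidAlgebra.single (FreeMonoid.of a) 1).prod

@[simp] lemma magnus_nil : magnus ([] : List α) = 1 := rfl

lemma magnus_append (u v : List α) : magnus (u ++ v) = magnus u * magnus v := by simp [magnus]

lemma magnus_singleton (a : α) :
    magnus [a] = 1 + MonoidAlgebra.single (FreeMonoid.of a) 1 := by simp [magnus]

lemma magnus_sub_one_mem_orderGE (w : List α) : magnus w - 1 ∈ orderGE ℤ α 1 := by
  induction w with
  | nil => simp
  | cons a w ih =>
    have e : magnus (a :: w) - 1 =
        (magnus w - 1) + MonoidAlgebra.single (FreeMonoid.of a) 1 * magnus w := by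
      rw [← List.singleton_append, magnus_append, magnus_singleton]; noncomm_ring
    exact e ▸ add_mem ih (mul_mem_orderGE (single_of_mem_orderGE a 1) (mem_orderGE_zero _))

lemma magnus_eq_sum_sublists (w : List α) :
    magnus w =
      (w.sublists.map fun y => MonoidAlgebra.single (FreeMonoid.ofList y) (1 : ℤ)).sum := by
  induction w using List.reverseRecOn with
  | nil => simp [MonoidAlgebra.one_def]
  | append_singleton w a ih =>
    rw [magnus_append, ih, magnus_singleton, List.sublists_concat, List.map_append,
      List.sum_append, mul_add, mul_one, List.map_map, ← List.sum_map_mul_right]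
    congr 3
    funext y
    simp [MonoidAlgebra.single_mul_single, FreeMonoid.ofList_append]

lemma coeff_magnus [DecidableEq α] (w x : List α) :
    (magnus w).coeff (FreeMonoid.ofList x) = w.sublists.count x := by
  rw [magnus_eq_sum_sublists]
  induction w.sublists with
  | nil => simp
  | cons y l ih =>
    have hsingle : Finsupp.single (FreeMonoid.ofList y) (1 : ℤ) (FreeMonoid.ofList x) =
        if y = x then 1 else 0 := by
      classical
      exact Finsupp.single_apply.trans (if_congr (Equiv.apply_eq_iff_eq _) rfl rfl)
    simp [ih, List.count_cons, hsingle, add_comm]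

end Magnus

section BinomEquiv

lemma binomEquiv_iff {k : ℕ} {u v : Word} :
    BinomEquiv k u v ↔ magnus u - magnus v ∈ orderGE ℤ Bool (k + 1) := by
  have coeff_sub (x : Word) : (magnus u - magnus v).coeff (FreeMonoid.ofList x) =
      (binom u x : ℤ) - binom v x := by
    simp [coeff_magnus, binom]
  have coeff_eq_zero (x : Word) : (magnus u - magnus v).coeff (FreeMonoid.ofList x) = 0 ↔
      binom u x = binom v x := by
    rw [coeff_sub, sub_eq_zero, Nat.cast_inj]
  exact ⟨fun h x hx => (coeff_eq_zero x).2 (h x (Nat.lt_succ_iff.1 hx)),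
    fun h x hx => (coeff_eq_zero x).1 (h x (Nat.lt_succ_iff.2 hx))⟩

lemma BinomEquiv.refl (k : ℕ) (u : Word) : BinomEquiv k u u := fun _ _ => rfl

lemma BinomEquiv.trans {k : ℕ} {u v w : Word} (h : BinomEquiv k u v) (h' : BinomEquiv k v w) :
    BinomEquiv k u w := fun x hx => (h x hx).trans (h' x hx)

lemma BinomEquiv.append {k : ℕ} {u v u' v' : Word} (h : BinomEquiv k u v)
    (h' : BinomEquiv k u' v') : BinomEquiv k (u ++ u') (v ++ v') := by
  rw [binomEquiv_iff] at h h' ⊢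
  have e : magnus (u ++ u') - magnus (v ++ v') =
      (magnus u - magnus v) * magnus u' + magnus v * (magnus u' - magnus v') := by
    rw [magnus_append, magnus_append]; noncomm_ring
  rw [e]
  refine add_mem (mul_mem_orderGE (j := 0) h (mem_orderGE_zero _)) ?_
  simpa only [zero_add] using mul_mem_orderGE (mem_orderGE_zero (magnus v)) h'

lemma BinomEquiv.append_comm {k : ℕ} {u v : Word} (h : BinomEquiv k u v) :
    BinomEquiv (k + 1) (u ++ v) (v ++ u) := by
  rw [binomEquiv_iff] at h ⊢
  have e : magnus (u ++ v) - magnus (v ++ u) =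
      (magnus u - magnus v) * (magnus v - 1) - (magnus v - 1) * (magnus u - magnus v) := by
    rw [magnus_append, magnus_append]; noncomm_ring
  rw [e]
  refine sub_mem (mul_mem_orderGE h (magnus_sub_one_mem_orderGE v)) ?_
  rw [add_comm]
  exact mul_mem_orderGE (magnus_sub_one_mem_orderGE v) h

lemma binomEquiv_φ_iterate_singleton (k : ℕ) (a b : Bool) :
    BinomEquiv k (φ^[k] [a]) (φ^[k] [b]) := by
  induction k generalizing a b with
  | zero =>
    intro x hx
    rw [List.length_eq_zero_iff.1 (Nat.le_zero.1 hx)]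
    rfl
  | succ k ih =>
    obtain rfl | rfl := Bool.eq_or_eq_not b a
    · exact .refl _ _
    · simpa only [φ_iterate_succ_singleton, Bool.not_not] using (ih a (!a)).append_comm

lemma binomEquiv_φ_iterate_of_perm (k : ℕ) {x y : Word} (h : x.Perm y) :
    BinomEquiv (k + 1) (φ^[k] x) (φ^[k] y) := by
  induction h with
  | nil => exact .refl _ _
  | @cons a x y _ ih =>
    rw [φ_iterate_cons k a x, φ_iterate_cons k a y]
    exact (BinomEquiv.refl _ _).append ih
  | swap a b x =>
    rw [show b :: a :: x = [b] ++ [a] ++ x from rfl, show a :: b :: x = [a] ++ [b] ++ x from rfl]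
    simp only [φ_iterate_append]
    exact (binomEquiv_φ_iterate_singleton k b a).append_comm.append (.refl _ _)
  | trans _ _ ih₁ ih₂ => exact ih₁.trans ih₂

lemma binomEquiv_of_balance_eq {k : ℕ} {u v p s x y : Word} (hu : u = p ++ φ^[k] x ++ s)
    (hv : v = p ++ φ^[k] y ++ s) (hlen : u.length = v.length) (hbal : balance x = balance y) :
    BinomEquiv (k + 1) u v := by
  subst hu hv
  simp only [List.length_append, length_φ_iterate, add_left_inj, add_right_inj] at hlen
  have hxy : x.Perm y := perm_of_balance_eq (Nat.eq_of_mul_eq_mul_left (by positivity) hlen) hbal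
  exact ((BinomEquiv.refl _ p).append (binomEquiv_φ_iterate_of_perm k hxy)).append (.refl _ s)

theorem binomEquiv_of_typeEquiv {k : ℕ} {p₁ s₁ p₂ s₂ w₁ w₂ : Word}
    (hlen : (p₁ ++ φ^[k + 1] w₁ ++ s₁).length = (p₂ ++ φ^[k + 1] w₂ ++ s₂).length)
    (h : TypeEquiv (k + 1) (p₁, s₁) (p₂, s₂)) :
    BinomEquiv (k + 1) (p₁ ++ φ^[k + 1] w₁ ++ s₁) (p₂ ++ φ^[k + 1] w₂ ++ s₂) := by
  have of_halves (p s x₁ y₁ x₂ y₂ : Word) (h₁ : p₁ = p ++ φ^[k] x₁) (h₁' : s₁ = φ^[k] y₁ ++ s)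
      (h₂ : p₂ = p ++ φ^[k] x₂) (h₂' : s₂ = φ^[k] y₂ ++ s)
      (hbal : balance x₁ + balance y₁ = balance x₂ + balance y₂) :
      BinomEquiv (k + 1) (p₁ ++ φ^[k + 1] w₁ ++ s₁) (p₂ ++ φ^[k + 1] w₂ ++ s₂) :=
    binomEquiv_of_balance_eq (p := p) (s := s) (x := x₁ ++ φ w₁ ++ y₁) (y := x₂ ++ φ w₂ ++ y₂)
      (by simp [h₁, h₁']) (by simp [h₂, h₂']) hlen (by simpa using hbal)
  obtain ⟨-, a, ⟨-, h | h | h | h⟩ | ⟨-, h | h⟩⟩ := h <;>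
    simp only [Prod.mk.injEq, Nat.add_sub_cancel] at h
  · exact of_halves p₂ s₂ [] [] [] [] (by simp [h]) (by simp [h]) (by simp) (by simp) rfl
  · exact of_halves p₂ s₁ [a] [] [] [a] h.1 (by simp) (by simp) h.2.symm (by simp)
  · exact of_halves p₁ s₂ [] [a] [a] [] (by simp) h.2.symm h.1 (by simp) (by simp)
  · exact of_halves [] [] [a] [!a] [!a] [a] h.1.1 (by simp [h]) (by simp [h]) (by simp [h])
      (add_comm _ _)
  · exact of_halves p₂ s₂ [a] [!a] [] [] h.1 h.2 (by simp) (by simp) (by simp [ε_not])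
  · exact of_halves p₁ s₁ [] [] [a] [!a] (by simp) (by simp) h.1 h.2 (by simp [ε_not])

end BinomEquiv

section Weight

/-- The coefficient with which a subsequence contributes to the sign polynomial at `1 + z`:
only its last letter counts with its sign, the others choose the term `z` of `1 + z`. -/
def lastWeight {R : Type*} [CommRing R] (z : R) (y : Word) : R :=
  z ^ (y.length - 1) * (y.getLast?.elim 0 ε : ℤ)

variable {R : Type*}

lemma sum_pow_length_sublists [CommSemiring R] {α : Type*} (z : R) (w : List α) :
    (w.sublists.map fun y => z ^ y.length).sum = (1 + z) ^ w.length := by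
  induction w using List.reverseRecOn with
  | nil => simp
  | append_singleton w a ih =>
    simp [List.sublists_concat, Function.comp_def, pow_succ, List.sum_map_mul_right, ih]
    ring

lemma sum_lastWeight_sublists [CommRing R] (z : R) (w : Word) :
    (w.sublists.map (lastWeight z)).sum = signPoly (1 + z) w := by
  induction w using List.reverseRecOn with
  | nil => simp [lastWeight]
  | append_singleton w a ih =>
    simp [List.sublists_concat, Function.comp_def, ih, signPoly_append, lastWeight,
      List.sum_map_mul_right, sum_pow_length_sublists]

lemma BinomEquiv.dvd_sum_sublists_sub [CommRing R] {k : ℕ} {u v : Word} (h : BinomEquiv k u v)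
    {d : R} {g : Word → R} (hg : ∀ y, k < y.length → d ∣ g y) :
    d ∣ (u.sublists.map g).sum - (v.sublists.map g).sum := by
  have sum_eq (w : Word) (U : Finset Word) (hU : w.sublists.toFinset ⊆ U) :
      (w.sublists.map g).sum = ∑ y ∈ U, (binom w y : R) * g y := by
    have count_eq (y : Word) : @List.count _ instBEqOfDecidableEq y w.sublists = binom w y := by
      unfold binom
      congr!
    rw [Finset.sum_list_map_count, Finset.sum_subset hU]
    · simp only [count_eq, nsmul_eq_mul]
    · intro y _ hy
      rw [count_eq, binom, List.count_eq_zero_of_not_mem (by simpa using hy), zero_smul]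
  rw [sum_eq u _ Finset.subset_union_left, sum_eq v _ Finset.subset_union_right,
    ← Finset.sum_sub_distrib]
  refine Finset.dvd_sum fun y _ => ?_
  rcases le_or_gt y.length k with hy | hy
  · rw [h y hy, sub_self]; exact dvd_zero _
  · exact dvd_sub ((hg y hy).mul_left _) ((hg y hy).mul_left _)

theorem BinomEquiv.X_pow_dvd_signPoly_sub {k : ℕ} {u v : Word} (h : BinomEquiv k u v) :
    X ^ k ∣ signPoly (1 + X : ℤ[X]) u - signPoly (1 + X : ℤ[X]) v := by
  rw [← sum_lastWeight_sublists, ← sum_lastWeight_sublists]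
  exact h.dvd_sum_sublists_sub fun y hy => (pow_dvd_pow X (Nat.le_sub_one_of_lt hy)).mul_right _

end Weight

/-- A factor `t_{[start, start + left + 2^k blocks + right)}` of the Thue–Morse word, cut at its
outermost cutting bars of order `k`: these are the bars number `first` and `first + blocks`. -/
structure BlockCut (k : ℕ) where
  start : ℕ
  left : ℕ
  first : ℕ
  blocks : ℕ
  right : ℕ
  left_lt : left < 2 ^ k
  right_lt : right < 2 ^ k
  start_add_left : start + left = 2 ^ k * first

namespace BlockCut

variable {k : ℕ} (C : BlockCut k)

/-- The number of the last cutting bar. -/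
def last : ℕ := C.first + C.blocks

/-- The length of the factor. -/
def length : ℕ := C.left + 2 ^ k * C.blocks + C.right

/-- The part of the factor before its first cutting bar. -/
def leftWord : Word := tFactor C.start C.left

/-- The word `w` such that `φ^k(w)` is the part of the factor between its outermost cutting bars. -/
def core : Word := tFactor C.first C.blocks

/-- The part of the factor after its last cutting bar. -/
def rightWord : Word := tFactor (2 ^ k * C.last) C.right

/-- The factor itself. -/
def word : Word := C.leftWord ++ φ^[k] C.core ++ C.rightWord

/-- The factorization `(p, s)` given by the cut. -/
def type : Word × Word := (C.leftWord, C.rightWord)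

@[simp] lemma length_leftWord : C.leftWord.length = C.left := length_tFactor _ _

@[simp] lemma length_core : C.core.length = C.blocks := length_tFactor _ _

@[simp] lemma length_rightWord : C.rightWord.length = C.right := length_tFactor _ _

@[simp] lemma length_word : C.word.length = C.length := by
  simp [word, length, add_assoc]

lemma word_eq_tFactor : C.word = tFactor C.start C.length := by
  rw [word, leftWord, core, rightWord, length, last, φ_iterate_tFactor, tFactor_add, tFactor_add,
    ← add_assoc, C.start_add_left, mul_add]

lemma two_lt_blocks (h : 2 ^ (k + 2) ≤ C.length + 1) : 2 < C.blocks := by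
  by_contra! hle
  have hmul := Nat.mul_le_mul_left (2 ^ k) hle
  have hleft := C.left_lt
  have hright := C.right_lt
  rw [length, pow_add] at h
  lia

lemma exists_first_eq_add_one (h : C.leftWord ≠ []) : ∃ e, C.first = e + 1 := by
  have hpos : 0 < C.left := by simpa using List.length_pos_iff.2 h
  refine Nat.exists_eq_add_one_of_ne_zero fun hfirst => ?_
  have hstart := C.start_add_left
  rw [hfirst] at hstart
  lia

section Letters

variable {C} {D : BlockCut k}

lemma blocks_eq_of_type_eq (h : C.type = D.type) (hlen : C.length = D.length) :
    C.blocks = D.blocks := by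
  have hleft : C.left = D.left := by simpa [type] using congrArg (·.1.length) h
  have hright : C.right = D.right := by simpa [type] using congrArg (·.2.length) h
  rw [length, length, hleft, hright] at hlen
  exact Nat.eq_of_mul_eq_mul_left (Nat.two_pow_pos k) (by lia)

lemma exists_t_eq_of_leftWord_eq (h : C.leftWord = D.leftWord) (hne : C.leftWord ≠ []) :
    ∃ c d, C.first = c + 1 ∧ D.first = d + 1 ∧ t c = t d := by
  have hleft : C.left = D.left := by simpa using congrArg List.length h
  have t_last (E : BlockCut k) (hE : E.leftWord ≠ []) : ∃ e, E.first = e + 1 ∧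
      t (E.start + (E.left - 1)) = xor (t e) (t (2 ^ k - 1)) := by
    obtain ⟨e, he⟩ := E.exists_first_eq_add_one hE
    have hpos : 0 < E.left := by simpa using List.length_pos_iff.2 hE
    have hstart := E.start_add_left
    refine ⟨e, he, ?_⟩
    rw [← t_two_pow_mul_add k e (Nat.sub_one_lt (by positivity))]
    rw [he, mul_add] at hstart
    congr 1
    have := E.left_lt
    lia
  obtain ⟨c, hc, hct⟩ := t_last C hne
  obtain ⟨d, hd, hdt⟩ := t_last D (h ▸ hne)
  have hpos : 0 < C.left := by simpa using List.length_pos_iff.2 hne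
  refine ⟨c, d, hc, hd, ?_⟩
  have hlast := tFactor_eq_iff.1 (show tFactor C.start C.left = tFactor D.start C.left by
    simpa only [leftWord, ← hleft] using h) (C.left - 1) (by lia)
  rw [hct, hleft, hdt] at hlast
  exact Bool.xor_left_inj.1 hlast

lemma t_last_eq_of_rightWord_eq (h : C.rightWord = D.rightWord) (hne : C.rightWord ≠ []) :
    t C.last = t D.last := by
  have hright : C.right = D.right := by simpa using congrArg List.length h
  have hpos : 0 < C.right := by simpa using List.length_pos_iff.2 hne
  have hfirst := tFactor_eq_iff.1 (show tFactor _ C.right = tFactor _ C.right by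
    simpa only [rightWord, ← hright] using h) 0 hpos
  rw [t_two_pow_mul_add _ _ (by positivity), t_two_pow_mul_add _ _ (by positivity)] at hfirst
  exact Bool.xor_left_inj.1 hfirst

end Letters

end BlockCut

section Halving

namespace BlockCut

variable {k : ℕ} (C : BlockCut (k + 1))

/-- The same factor, cut at its outermost cutting bars of order `k`. -/
def halve : BlockCut k where
  start := C.start
  left := C.left % 2 ^ k
  first := 2 * C.first - C.left / 2 ^ k
  blocks := C.left / 2 ^ k + 2 * C.blocks + C.right / 2 ^ k
  right := C.right % 2 ^ k
  left_lt := Nat.mod_lt _ (by positivity)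
  right_lt := Nat.mod_lt _ (by positivity)
  start_add_left := by
    have hstart := C.start_add_left
    have hleft := Nat.div_add_mod C.left (2 ^ k)
    rw [pow_succ, mul_assoc] at hstart
    rw [Nat.mul_sub]
    lia

/-- The word `x` of length at most one with `C.leftWord = C.halve.leftWord ++ φ^k(x)`. -/
def leftHalf : Word := tFactor C.halve.first (C.left / 2 ^ k)

/-- The word `y` of length at most one with `C.rightWord = φ^k(y) ++ C.halve.rightWord`. -/
def rightHalf : Word := tFactor (2 * C.last) (C.right / 2 ^ k)

lemma length_leftHalf : C.leftHalf.length = C.left / 2 ^ k := length_tFactor _ _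

lemma length_rightHalf : C.rightHalf.length = C.right / 2 ^ k := length_tFactor _ _

lemma length_leftHalf_le : C.leftHalf.length ≤ 1 := by
  rw [length_leftHalf]
  exact Nat.le_of_lt_succ (Nat.div_lt_of_lt_mul (by simpa [pow_succ] using C.left_lt))

lemma length_rightHalf_le : C.rightHalf.length ≤ 1 := by
  rw [length_rightHalf]
  exact Nat.le_of_lt_succ (Nat.div_lt_of_lt_mul (by simpa [pow_succ] using C.right_lt))

lemma halve_first_add_div : C.halve.first + C.left / 2 ^ k = 2 * C.first := by
  refine Nat.sub_add_cancel (Nat.div_le_of_le_mul ?_)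
  have hstart := C.start_add_left
  rw [pow_succ, mul_assoc] at hstart
  lia

lemma halve_blocks :
    C.halve.blocks = C.leftHalf.length + 2 * C.blocks + C.rightHalf.length := by
  rw [length_leftHalf, length_rightHalf]
  rfl

lemma halve_last : C.halve.last = 2 * C.last + C.right / 2 ^ k := by
  have := C.halve_first_add_div
  simp only [last, halve_blocks, length_leftHalf, length_rightHalf]
  lia

lemma leftWord_eq : C.leftWord = C.halve.leftWord ++ φ^[k] C.leftHalf := by
  rw [leftHalf, φ_iterate_tFactor, ← C.halve.start_add_left]
  conv_lhs => rw [leftWord, ← Nat.mod_add_div C.left (2 ^ k), tFactor_add]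
  rfl

lemma rightWord_eq : C.rightWord = φ^[k] C.rightHalf ++ C.halve.rightWord := by
  rw [rightHalf, rightWord, rightWord, halve_last, φ_iterate_tFactor, mul_add, ← mul_assoc,
    ← pow_succ]
  conv_lhs => rw [← Nat.div_add_mod C.right (2 ^ k), tFactor_add]
  rfl

lemma core_halve : C.halve.core = C.leftHalf ++ φ C.core ++ C.rightHalf := by
  rw [leftHalf, core, core, rightHalf, φ_tFactor, last, mul_add, ← halve_first_add_div,
    ← tFactor_add, add_assoc, ← tFactor_add]
  rfl

lemma word_halve : C.halve.word = C.word := by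
  rw [word, word, core_halve, leftWord_eq, rightWord_eq, Function.iterate_succ_apply]
  simp only [φ_iterate_append, List.append_assoc]

lemma length_halve : C.halve.length = C.length := by
  rw [← length_word, ← length_word, word_halve]

lemma balance_core_halve : balance C.halve.core = balance C.leftHalf + balance C.rightHalf := by
  simp [core_halve]

lemma moment_core_halve : moment C.halve.core =
    -balance C.core + (C.leftHalf.length + 2 * C.blocks) * balance C.rightHalf := by
  simp only [core_halve, moment_append, moment_φ, List.length_append, length_φ, length_core,
    moment_eq_zero_of_length_le_one C.length_leftHalf_le, balance_φ,
    moment_eq_zero_of_length_le_one C.length_rightHalf_le]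
  push_cast
  ring

variable {C} {a : Bool}

lemma exists_of_leftHalf_eq_singleton (h : C.leftHalf = [a]) :
    ∃ e, C.first = e + 1 ∧ C.halve.first = 2 * e + 1 ∧ t e = !a := by
  have hlen := congrArg List.length h
  rw [length_leftHalf, List.length_singleton] at hlen
  have hfirst := C.halve_first_add_div
  refine ⟨C.first - 1, by lia, by lia, ?_⟩
  rw [leftHalf, hlen, tFactor_one, show C.halve.first = 2 * (C.first - 1) + 1 by lia,
    t_two_mul_add_one, List.singleton_inj] at h
  rw [← h, Bool.not_not]

lemma halve_last_of_rightHalf_eq_singleton (h : C.rightHalf = [a]) :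
    C.halve.last = 2 * C.last + 1 ∧ t C.last = a := by
  have hlen := congrArg List.length h
  rw [length_rightHalf, List.length_singleton] at hlen
  refine ⟨by rw [halve_last, hlen], ?_⟩
  rwa [rightHalf, hlen, tFactor_one, t_two_mul, List.singleton_inj] at h

end BlockCut

end Halving

section Classification

/-- The alternatives are those in the definition of `≡_k`, with `φ^(k-1)` stripped off. -/
lemma eq_or_exists_of_balance_add_balance_eq {x₁ y₁ x₂ y₂ : Word} (hx₁ : x₁.length ≤ 1)
    (hy₁ : y₁.length ≤ 1) (hx₂ : x₂.length ≤ 1) (hy₂ : y₂.length ≤ 1)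
    (h : balance x₁ + balance y₁ = balance x₂ + balance y₂) :
    (x₁ = x₂ ∧ y₁ = y₂) ∨ ∃ a,
      (x₁ = [a] ∧ y₁ = [] ∧ x₂ = [] ∧ y₂ = [a]) ∨
      (x₂ = [a] ∧ y₂ = [] ∧ x₁ = [] ∧ y₁ = [a]) ∨
      (x₁ = [a] ∧ y₁ = [!a] ∧ x₂ = [!a] ∧ y₂ = [a]) ∨
      (x₁ = [a] ∧ y₁ = [!a] ∧ x₂ = [] ∧ y₂ = []) ∨
      (x₂ = [a] ∧ y₂ = [!a] ∧ x₁ = [] ∧ y₁ = []) := by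
  have eq_of_length_le_one {w : Word} (hw : w.length ≤ 1) : w = [] ∨ w = [false] ∨ w = [true] := by
    rcases w with _ | ⟨_ | _, _ | _⟩ <;> simp_all
  rcases eq_of_length_le_one hx₁ with rfl | rfl | rfl <;>
  rcases eq_of_length_le_one hy₁ with rfl | rfl | rfl <;>
  rcases eq_of_length_le_one hx₂ with rfl | rfl | rfl <;>
  rcases eq_of_length_le_one hy₂ with rfl | rfl | rfl <;>
  simp [ε] at h ⊢

namespace BlockCut

variable {k : ℕ} {C D : BlockCut (k + 1)} {a : Bool}

lemma moment_core_halve_ne_of_swap (hblocks : C.halve.blocks = D.halve.blocks)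
    (hCl : C.leftHalf = [a]) (hCr : C.rightHalf = [!a]) (hDl : D.leftHalf = [!a])
    (hDr : D.rightHalf = [a]) : moment C.halve.core ≠ moment D.halve.core := by
  have hC := abs_le.1 (abs_balance_le C.core)
  have hD := abs_le.1 (abs_balance_le D.core)
  simp only [halve_blocks, hCl, hCr, hDl, hDr, List.length_singleton] at hblocks
  simp only [moment_core_halve, hCl, hCr, hDl, hDr, List.length_singleton, length_core] at hC hD ⊢
  cases a <;> simp [ε] <;> lia

lemma blocks_le_one_of_core_eq_replicate (hl : C.leftHalf = [a])
    (hcore : C.core = List.replicate C.blocks (!a)) : C.blocks ≤ 1 := by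
  obtain ⟨e, hfirst, -, he⟩ := exists_of_leftHalf_eq_singleton hl
  have hrun : tFactor e (1 + C.blocks) = List.replicate (1 + C.blocks) (!a) := by
    rw [tFactor_add, ← hfirst, tFactor_one, he, ← core, hcore, List.replicate_add]
    rfl
  have := le_two_of_tFactor_eq_replicate hrun
  lia

lemma blocks_eq_zero_of_core_eq_replicate (hl : C.leftHalf = [a]) (hr : C.rightHalf = [!a])
    (hcore : C.core = List.replicate C.blocks (!a)) : C.blocks = 0 := by
  obtain ⟨e, hfirst, -, he⟩ := exists_of_leftHalf_eq_singleton hl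
  have hrun : tFactor e (1 + C.blocks + 1) = List.replicate (1 + C.blocks + 1) (!a) := by
    rw [tFactor_add, tFactor_add, ← add_assoc, ← hfirst, tFactor_one, he, ← core, hcore, ← last,
      tFactor_one, (halve_last_of_rightHalf_eq_singleton hr).2, List.replicate_add,
      List.replicate_add]
    rfl
  have := le_two_of_tFactor_eq_replicate hrun
  lia

lemma moment_core_halve_ne_of_around (hblocks : C.halve.blocks = D.halve.blocks)
    (htwo : 2 < C.halve.blocks) (hCl : C.leftHalf = [a]) (hCr : C.rightHalf = [!a])
    (hDl : D.leftHalf = []) (hDr : D.rightHalf = []) :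
    moment C.halve.core ≠ moment D.halve.core := by
  intro hmom
  have hC := abs_le.1 (abs_balance_le C.core)
  have hD := abs_le.1 (abs_balance_le D.core)
  simp only [halve_blocks, hCl, hCr, hDl, hDr, List.length_singleton, List.length_nil]
    at hblocks htwo
  simp only [moment_core_halve, hCl, hCr, hDl, hDr, List.length_singleton, List.length_nil,
    length_core] at hC hD hmom
  have hbal : balance C.core = C.core.length * ε (!a) := by
    rw [length_core]
    cases a <;> simp [ε] at hmom ⊢ <;> lia
  have hcore := eq_replicate_of_balance_eq hbal
  rw [length_core] at hcore
  have := blocks_eq_zero_of_core_eq_replicate hCl hCr hcore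
  lia

lemma core_halve_eq_of_comm (hblocks : C.halve.blocks = D.halve.blocks)
    (htwo : 2 < C.halve.blocks) (hCl : C.leftHalf = [a]) (hCr : C.rightHalf = [])
    (hDl : D.leftHalf = []) (hDr : D.rightHalf = [a])
    (hmom : moment C.halve.core = moment D.halve.core) : C.halve.core = D.halve.core := by
  have hC := abs_le.1 (abs_balance_le C.core)
  have hD := abs_le.1 (abs_balance_le D.core)
  simp only [halve_blocks, hCl, hCr, hDl, hDr, List.length_singleton, List.length_nil]
    at hblocks htwo
  simp only [moment_core_halve, hCl, hCr, hDl, hDr, List.length_singleton, List.length_nil,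
    length_core] at hC hD hmom
  have hbalC : balance C.core = C.core.length * ε (!a) := by
    rw [length_core]
    cases a <;> simp [ε] at hmom ⊢ <;> lia
  have hbalD : balance D.core = D.core.length * ε a := by
    rw [length_core]
    cases a <;> simp [ε] at hmom ⊢ <;> lia
  have hcoreC := eq_replicate_of_balance_eq hbalC
  have hcoreD := eq_replicate_of_balance_eq hbalD
  rw [length_core] at hcoreC hcoreD
  have hone : C.blocks = 1 := by
    have := blocks_le_one_of_core_eq_replicate hCl hcoreC
    lia
  rw [core_halve, core_halve, hCl, hCr, hDl, hDr, hcoreC, hcoreD, hone,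
    show D.blocks = 1 by lia]
  simp

lemma type_eq_of_halves_eq (htype : C.halve.type = D.halve.type)
    (hl : C.leftHalf = D.leftHalf) (hr : C.rightHalf = D.rightHalf) : C.type = D.type := by
  obtain ⟨hp, hs⟩ := Prod.mk.inj htype
  simp only [type, leftWord_eq, rightWord_eq, hp, hs, hl, hr]

lemma word_eq_of_core_halve_eq (htype : C.halve.type = D.halve.type)
    (hcore : C.halve.core = D.halve.core) : C.word = D.word := by
  obtain ⟨hp, hs⟩ := Prod.mk.inj htype
  rw [← C.word_halve, ← D.word_halve, word, word, hp, hs, hcore]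

/-- When the halves differ, `|balance w| ≤ |w|` excludes a swap of the halves and is attained in the
other cases, where a core is thus constant and extends to a run of equal letters; but `t` has no run
of length three. -/
lemma word_eq_or_type_eq_of_moment_eq (htype : C.halve.type = D.halve.type)
    (hblocks : C.halve.blocks = D.halve.blocks) (htwo : 2 < C.halve.blocks)
    (hbal : balance C.halve.core = balance D.halve.core)
    (hmom : moment C.halve.core = moment D.halve.core) : C.word = D.word ∨ C.type = D.type := by
  rw [balance_core_halve, balance_core_halve] at hbal
  have htwoD : 2 < D.halve.blocks := hblocks ▸ htwo
  obtain ⟨hl, hr⟩ | ⟨a, ⟨h₁, h₂, h₃, h₄⟩ | ⟨h₁, h₂, h₃, h₄⟩ | ⟨h₁, h₂, h₃, h₄⟩ |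
      ⟨h₁, h₂, h₃, h₄⟩ | ⟨h₁, h₂, h₃, h₄⟩⟩ := eq_or_exists_of_balance_add_balance_eq
    C.length_leftHalf_le C.length_rightHalf_le D.length_leftHalf_le D.length_rightHalf_le hbal
  · exact .inr (type_eq_of_halves_eq htype hl hr)
  · exact .inl (word_eq_of_core_halve_eq htype
      (core_halve_eq_of_comm hblocks htwo h₁ h₂ h₃ h₄ hmom))
  · exact .inl (word_eq_of_core_halve_eq htype
      (core_halve_eq_of_comm hblocks.symm htwoD h₁ h₂ h₃ h₄ hmom.symm).symm)
  · exact (moment_core_halve_ne_of_swap hblocks h₁ h₂ h₃ h₄ hmom).elim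
  · exact (moment_core_halve_ne_of_around hblocks htwo h₁ h₂ h₃ h₄ hmom).elim
  · exact (moment_core_halve_ne_of_around hblocks.symm htwoD h₁ h₂ h₃ h₄ hmom.symm).elim

lemma halve_type_eq_nil_of_swap (htype : C.halve.type = D.halve.type)
    (hCl : C.leftHalf = [a]) (hCr : C.rightHalf = [!a]) (hDl : D.leftHalf = [!a])
    (hDr : D.rightHalf = [a]) : D.halve.type = ([], []) := by
  obtain ⟨hl, hr⟩ := Prod.mk.inj htype
  refine Prod.ext ?_ ?_ <;> by_contra hne
  · obtain ⟨c, d, hc, hd, hcd⟩ := exists_t_eq_of_leftWord_eq hl (hl ▸ hne)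
    obtain ⟨e, -, hce, he⟩ := exists_of_leftHalf_eq_singleton hCl
    obtain ⟨f, -, hdf, hf⟩ := exists_of_leftHalf_eq_singleton hDl
    rw [show c = 2 * e by lia, show d = 2 * f by lia, t_two_mul, t_two_mul, he, hf] at hcd
    simp at hcd
  · have hcd := t_last_eq_of_rightWord_eq hr (hr ▸ hne)
    obtain ⟨hce, he⟩ := halve_last_of_rightHalf_eq_singleton hCr
    obtain ⟨hdf, hf⟩ := halve_last_of_rightHalf_eq_singleton hDr
    rw [hce, hdf, t_two_mul_add_one, t_two_mul_add_one, he, hf] at hcd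
    simp at hcd

lemma typeEquiv_of_halve_type_eq (htype : C.halve.type = D.halve.type)
    (hbal : balance C.halve.core = balance D.halve.core) : TypeEquiv (k + 1) C.type D.type := by
  refine ⟨by simp [type, left_lt, right_lt], ?_⟩
  obtain ⟨hl, hr⟩ := Prod.mk.inj htype
  rw [balance_core_halve, balance_core_halve] at hbal
  simp only [type, leftWord_eq, rightWord_eq, hl, hr, Nat.add_sub_cancel]
  have abs_sub_eq (x y : ℤ) : |x + 2 ^ k + (2 ^ k + y) - (x + y)| = 2 ^ (k + 1) := by
    rw [← abs_of_pos (show (0 : ℤ) < 2 ^ (k + 1) by positivity)]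
    ring_nf
  obtain ⟨h₁, h₂⟩ | ⟨a, h | h | h | h | h⟩ := eq_or_exists_of_balance_add_balance_eq
    C.length_leftHalf_le C.length_rightHalf_le D.length_leftHalf_le D.length_rightHalf_le hbal
  · exact ⟨default, .inl ⟨by simp [h₁, h₂], .inl (by rw [h₁, h₂])⟩⟩
  · exact ⟨a, .inl ⟨by simp [h]; ring, .inr (.inl (by simp [h]))⟩⟩
  · exact ⟨a, .inl ⟨by simp [h]; ring, .inr (.inr (.inl (by simp [h])))⟩⟩
  · obtain ⟨hnil, hnil'⟩ := Prod.mk.inj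
      (halve_type_eq_nil_of_swap htype h.1 h.2.1 h.2.2.1 h.2.2.2)
    exact ⟨a, .inl ⟨by simp [h], .inr (.inr (.inr (by simp [h, hnil, hnil'])))⟩⟩
  · exact ⟨a, .inr ⟨by simpa [h] using abs_sub_eq _ _, .inl (by simp [h])⟩⟩
  · exact ⟨a, .inr ⟨by rw [abs_sub_comm]; simpa [h] using abs_sub_eq _ _, .inr (by simp [h])⟩⟩

theorem word_eq_or_type_eq_of_X_pow_dvd {k : ℕ} {C D : BlockCut k} (hlen : C.length = D.length)
    (hlong : 2 ^ (k + 1) ≤ C.length + 1)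
    (h : X ^ (k + 1) ∣ signPoly (1 + X : ℤ[X]) C.word - signPoly (1 + X : ℤ[X]) D.word) :
    C.word = D.word ∨ C.type = D.type := by
  induction k with
  | zero =>
    have type_eq_nil (E : BlockCut 0) : E.type = ([], []) := by
      have hleft := E.left_lt
      have hright := E.right_lt
      rw [pow_zero, Nat.lt_one_iff] at hleft hright
      simp [type, leftWord, rightWord, hleft, hright]
    exact .inr ((type_eq_nil C).trans (type_eq_nil D).symm)
  | succ k ih =>
    rw [← C.word_halve, ← D.word_halve] at h ⊢
    rw [← C.length_halve, ← D.length_halve] at hlen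
    rw [← C.length_halve] at hlong
    refine (ih hlen (by rw [pow_succ] at hlong; lia) ((pow_dvd_pow X (by lia)).trans h)).elim
      .inl fun htype => ?_
    have hblocks := blocks_eq_of_type_eq htype hlen
    obtain ⟨hl, hr⟩ := Prod.mk.inj htype
    rw [word, word, hl, hr] at h
    rw [word_halve, word_halve]
    have hcore : C.halve.core.length = D.halve.core.length := by simpa using hblocks
    exact word_eq_or_type_eq_of_moment_eq htype hblocks (C.halve.two_lt_blocks hlong)
      (balance_eq_of_X_pow_dvd hcore ((pow_dvd_pow X (by lia)).trans h))
      (moment_eq_of_X_pow_dvd hcore h)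

theorem word_eq_or_typeEquiv_of_X_pow_dvd (hlen : C.length = D.length)
    (hlong : 2 ^ (k + 1) ≤ C.length + 1)
    (h : X ^ (k + 1) ∣ signPoly (1 + X : ℤ[X]) C.word - signPoly (1 + X : ℤ[X]) D.word) :
    C.word = D.word ∨ TypeEquiv (k + 1) C.type D.type := by
  rw [← C.word_halve, ← D.word_halve] at h ⊢
  rw [← C.length_halve, ← D.length_halve] at hlen
  rw [← C.length_halve] at hlong
  refine (word_eq_or_type_eq_of_X_pow_dvd hlen hlong h).imp_right fun htype => ?_
  obtain ⟨hl, hr⟩ := Prod.mk.inj htype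
  rw [word, word, hl, hr] at h
  exact typeEquiv_of_halve_type_eq htype
    (balance_eq_of_X_pow_dvd (by simpa using blocks_eq_of_type_eq htype hlen) h)

theorem binomEquiv_word_iff (hlen : C.length = D.length) (hlong : 2 ^ (k + 1) ≤ C.length + 1) :
    BinomEquiv (k + 1) C.word D.word ↔ C.word = D.word ∨ TypeEquiv (k + 1) C.type D.type := by
  refine ⟨fun h => word_eq_or_typeEquiv_of_X_pow_dvd hlen hlong h.X_pow_dvd_signPoly_sub, ?_⟩
  rintro (h | h)
  · exact h ▸ BinomEquiv.refl _ _
  · exact binomEquiv_of_typeEquiv (C.length_word.trans (hlen.trans D.length_word.symm)) h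

lemma typeEquiv_self {k : ℕ} (C : BlockCut k) : TypeEquiv k C.type C.type :=
  ⟨by simp [type, left_lt, right_lt], default, .inl ⟨rfl, .inl rfl⟩⟩

end BlockCut

end Classification

section Factorization

namespace BlockCut

variable {k : ℕ} (C : BlockCut k)

/-- The set of cutting bars of order `k` in the factor, counted from its start. -/
def cuttingSet : Set ℕ := {j | j ≤ C.word.length ∧ C.start + j ∈ Set.range (bar k)}

lemma isLeast_cuttingSet : IsLeast C.cuttingSet C.left := by
  refine ⟨⟨by simp [length, add_assoc], C.first, by rw [bar_eq, C.start_add_left]⟩, ?_⟩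
  rintro j ⟨-, e, he⟩
  rw [bar_eq] at he
  by_contra! hj
  have hstart := C.start_add_left
  have hleft := C.left_lt
  have hlt : e < C.first := Nat.lt_of_mul_lt_mul_left (a := 2 ^ k) (by lia)
  have := Nat.mul_le_mul_left (2 ^ k) hlt
  rw [Nat.mul_succ] at this
  lia

lemma isGreatest_cuttingSet : IsGreatest C.cuttingSet (C.left + 2 ^ k * C.blocks) := by
  refine ⟨⟨by simp [length], C.last, ?_⟩, ?_⟩
  · rw [bar_eq, last, mul_add, ← C.start_add_left, add_assoc]
  · rintro j ⟨hj, e, he⟩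
    rw [bar_eq] at he
    rw [length_word, length] at hj
    by_contra! hlt
    have hstart := C.start_add_left
    have hright := C.right_lt
    have hlast : C.last < e := Nat.lt_of_mul_lt_mul_left (a := 2 ^ k) (by
      rw [last, mul_add]
      lia)
    have := Nat.mul_le_mul_left (2 ^ k) hlast
    rw [Nat.mul_succ, last, mul_add] at this
    lia

lemma leftWord_eq_nil_or_exists_suffix : C.leftWord = [] ∨
    ∃ a : Bool, C.leftWord <:+ φ^[k] [a] ∧ C.leftWord ≠ φ^[k] [a] := by
  refine or_iff_not_imp_left.2 fun hne => ?_
  obtain ⟨e, he⟩ := C.exists_first_eq_add_one hne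
  refine ⟨t e, ?_, fun h => by simpa [C.left_lt.ne] using congrArg List.length h⟩
  have hstart := C.start_add_left
  have hpow : 2 ^ k = 2 ^ k - C.left + C.left := (Nat.sub_add_cancel C.left_lt.le).symm
  rw [he, Nat.mul_succ] at hstart
  rw [φ_iterate_letter]
  conv_rhs => rw [hpow, tFactor_add, ← hpow]
  rw [show 2 ^ k * e + (2 ^ k - C.left) = C.start by lia]
  exact List.suffix_append _ _

lemma exists_rightWord_prefix_φ_iterate :
    ∃ b : Bool, C.rightWord <+: φ^[k] [b] ∧ C.rightWord ≠ φ^[k] [b] := by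
  refine ⟨t C.last, ?_, fun h => by simpa [C.right_lt.ne] using congrArg List.length h⟩
  rw [φ_iterate_letter, ← Nat.add_sub_of_le C.right_lt.le, tFactor_add]
  rw [Nat.add_sub_of_le C.right_lt.le]
  exact List.prefix_append _ _

lemma isFactorization : IsFactorization k C.word C.type :=
  ⟨C.cuttingSet, ⟨⟨_, C.isLeast_cuttingSet.1⟩, C.start,
      by rw [length_word, word_eq_tFactor], rfl⟩,
    by simpa [type] using C.isLeast_cuttingSet,
    ⟨_, C.isGreatest_cuttingSet, by simp [type, length]⟩,
    ⟨C.core, rfl⟩, C.leftWord_eq_nil_or_exists_suffix,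
    .inr C.exists_rightWord_prefix_φ_iterate⟩

end BlockCut

lemma IsFactorization.exists_blockCut {k : ℕ} {u : Word} {q : Word × Word}
    (h : IsFactorization k u q) : ∃ C : BlockCut k, C.word = u ∧ C.type = q := by
  obtain ⟨p, s⟩ := q
  obtain ⟨_, ⟨-, i, hu, rfl⟩, ⟨⟨hpu, c, hc⟩, -⟩, ⟨M, ⟨⟨-, c', hc'⟩, hmax⟩, hs⟩, ⟨w, hw⟩,
    hp', hs'⟩ := h
  have hpM : p.length ≤ M := hmax ⟨hpu, c, hc⟩
  simp only [bar_eq] at hc hc' hs hp' hs' hw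
  have hpos : 0 < 2 ^ k := by positivity
  have hplt : p.length < 2 ^ k := by
    rcases hp' with rfl | ⟨a, h, hne⟩
    · exact hpos
    · simpa using h.length_le.lt_of_ne (mt h.eq_of_length hne)
  have hslt : s.length < 2 ^ k := by
    rcases hs' with rfl | ⟨b, h, hne⟩
    · exact hpos
    · simpa using h.length_le.lt_of_ne (mt h.eq_of_length hne)
  obtain ⟨m, rfl⟩ := Nat.exists_eq_add_of_le (Nat.le_of_mul_le_mul_left (c := 2 ^ k)
    (show 2 ^ k * c ≤ 2 ^ k * c' by lia) hpos)
  let C : BlockCut k := ⟨i, p.length, c, m, s.length, hplt, hslt, hc.symm⟩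
  have hlen : C.length = u.length := by
    rw [mul_add] at hc'
    simp only [BlockCut.length, C]
    lia
  have hword : C.word = u := by rw [C.word_eq_tFactor, hlen, hu.symm]
  obtain ⟨hleft, hright⟩ := List.append_inj' (hword.trans hw) (by simp [C])
  exact ⟨C, hword, Prod.ext (List.append_inj hleft (by simp [C])).1 hright⟩

lemma isFactorization_iff {k : ℕ} {u : Word} {q : Word × Word} :
    IsFactorization k u q ↔ ∃ C : BlockCut k, C.word = u ∧ C.type = q :=
  ⟨IsFactorization.exists_blockCut, by rintro ⟨C, rfl, rfl⟩; exact C.isFactorization⟩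

lemma exists_blockCut_word_eq {k n : ℕ} (hn : 2 ^ k - 1 ≤ n) (i : ℕ) :
    ∃ C : BlockCut k, C.word = tFactor i n := by
  have hpos : 0 < 2 ^ k := by positivity
  have hstart := Nat.div_add_mod (i + (2 ^ k - 1)) (2 ^ k)
  have hlt := Nat.mod_lt (i + (2 ^ k - 1)) hpos
  set left := 2 ^ k - 1 - (i + (2 ^ k - 1)) % 2 ^ k
  have hrest := Nat.div_add_mod (n - left) (2 ^ k)
  refine ⟨⟨i, left, (i + (2 ^ k - 1)) / 2 ^ k, (n - left) / 2 ^ k, (n - left) % 2 ^ k, by lia,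
    Nat.mod_lt _ hpos, by lia⟩, ?_⟩
  rw [BlockCut.word_eq_tFactor, BlockCut.length, add_assoc, hrest, Nat.add_sub_of_le (by lia)]

lemma BlockCut.type_eq_of_word_eq {k : ℕ} {C D : BlockCut k} (hword : C.word = D.word)
    (hleft : C.left = D.left) : C.type = D.type := by
  have hlen : C.length = D.length := by simpa using congrArg List.length hword
  have hright : C.right = D.right := by
    rw [length, length, hleft, add_assoc, add_assoc, add_right_inj] at hlen
    rw [← Nat.mod_eq_of_lt C.right_lt, ← Nat.mul_add_mod _ C.blocks, hlen, Nat.mul_add_mod,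
      Nat.mod_eq_of_lt D.right_lt]
  obtain ⟨hinit, hrest⟩ := List.append_inj' hword (by simpa using hright)
  exact Prod.ext (List.append_inj hinit (by simpa using hleft)).1 hrest

lemma exists_isMinFactorization_iff {k n : ℕ} (hn : 2 ^ k - 1 ≤ n) {u : Word} (hu : u ∈ Fac n) :
    ∃ C : BlockCut k, C.word = u ∧ ∀ q, IsMinFactorization k u q ↔ q = C.type := by
  obtain ⟨i, rfl⟩ := hu
  obtain ⟨C, hC, hmin⟩ := exists_minimalFor_of_wellFoundedLT
    (fun C : BlockCut k => C.word = tFactor i n) BlockCut.left (exists_blockCut_word_eq hn i)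
  have left_le (D : BlockCut k) (hD : D.word = tFactor i n) : C.left ≤ D.left :=
    (le_total C.left D.left).elim id (hmin hD)
  refine ⟨C, hC, fun q => ?_⟩
  simp only [IsMinFactorization, isFactorization_iff]
  constructor
  · rintro ⟨⟨D, hD, rfl⟩, hmin⟩
    have := hmin C.type ⟨C, hC, rfl⟩
    exact (BlockCut.type_eq_of_word_eq (hC.trans hD.symm)
      ((left_le D hD).antisymm (by simpa [BlockCut.type] using this))).symm
  · rintro rfl
    refine ⟨⟨C, hC, rfl⟩, ?_⟩
    rintro _ ⟨D, hD, rfl⟩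
    simpa [BlockCut.type] using left_le D hD

end Factorization

end ThueMorse

theorem mainTheorem2_general (k : ℕ) (hk : 1 ≤ k) (n : ℕ) (hn : 2 ^ k - 1 ≤ n)
    (u v : ThueMorse.Word) (hu : u ∈ ThueMorse.Fac n) (hv : v ∈ ThueMorse.Fac n) :
    ∃ qu qv : ThueMorse.Word × ThueMorse.Word,
      (∀ q, ThueMorse.IsMinFactorization k u q ↔ q = qu) ∧
      (∀ q, ThueMorse.IsMinFactorization k v q ↔ q = qv) ∧
      (ThueMorse.BinomEquiv k u v ↔ ThueMorse.TypeEquiv k qu qv) := by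
  obtain ⟨C, rfl, hC⟩ := ThueMorse.exists_isMinFactorization_iff hn hu
  obtain ⟨D, rfl, hD⟩ := ThueMorse.exists_isMinFactorization_iff hn hv
  refine ⟨C.type, D.type, hC, hD, ?_⟩
  have hCn := C.length_word.symm.trans (ThueMorse.length_of_mem_Fac hu)
  have hDn := D.length_word.symm.trans (ThueMorse.length_of_mem_Fac hv)
  have type_eq (h : C.word = D.word) : C.type = D.type := (hD _).1 (h ▸ (hC _).2 rfl)
  obtain ⟨k, rfl⟩ := Nat.exists_eq_add_of_le' hk
  rw [C.binomEquiv_word_iff (hCn.trans hDn.symm) (by lia)]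
  exact or_iff_right_of_imp fun h => type_eq h ▸ C.typeEquiv_self

theorem mainTheorem2 (k : ℕ) (hk : 3 ≤ k) (n : ℕ) (hn : 2 ^ k - 1 ≤ n)
    (u v : ThueMorse.Word) (hu : u ∈ ThueMorse.Fac n) (hv : v ∈ ThueMorse.Fac n) :
    ∃ qu qv : ThueMorse.Word × ThueMorse.Word,
      (∀ q, ThueMorse.IsMinFactorization k u q ↔ q = qu) ∧
      (∀ q, ThueMorse.IsMinFactorization k v q ↔ q = qv) ∧
      (ThueMorse.BinomEquiv k u v ↔ ThueMorse.TypeEquiv k qu qv) :=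
  mainTheorem2_general k (by lia) n hn u v hu hv
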